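/- For a finite simple graph $G$ with vertex set $V$ let $P_G=\operatorname{conv}\{\pm(e_i-e_j): \{i,j\}\in E(G)\}\subset\mathbb{R}^V$ be its symmetric edge polytope, and let $N(G)$ be the number of facets of $P_G$. For a vector $\mathbf m=(m_1,\dots,m_t)$ of positive integers let $CB(\mathbf m)$ be the graph made of $t$ internally disjoint paths of lengths $m_1,\dots,m_t$ connecting two common endpoints (several paths of length $1$ all give the same single edge between the endpoints). For a vector $\mathbf m$ of nonnegative integers, all of the same parity, with smallest entry $m_t$, put \[ F(\mathbf m)=\sum_{j=0}^{m_t}\binom{m_t}{j}\prod_{k=1}^{t-1}\binom{m_k}{\frac12(m_k-m_t)+j}. \] Let $C_n$ be the cycle with $n$ edges, where $C_2$ stands for the graph with two vertices and a single edge, and let $G\vee H$ denote any graph obtained by identifying a vertex of $G$ with a vertex of $H$. Let $\mathbf m$ be a vector of positive integers whose entries are, up to order, $e_1\ge\cdots\ge e_k$ even and $o_1\ge\cdots\ge o_\ell$ odd, with $k,\ell\ge 1$. Let $\mathbf m_e$ be the vector obtained from $\mathbf m$ by subtracting $1$ from every even entry, and $\mathbf m_o$ the vector obtained from $\mathbf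 m$ by subtracting $1$ from every odd entry. (i) If all entries of $\mathbf m$ are at least $2$, then \[ N(CB(\mathbf m))=\Bigl(\prod_{j=1}^k e_j\Bigr)F(\mathbf m_e)+\Bigl(\prod_{j=1}^{\ell} o_j\Bigr)F(\mathbf m_o). \] (ii) If some entry of $\mathbf m$ equals $1$, let $0\le p<\ell$ be such that $o_{p+1}=\cdots=o_\ell=1$ and $o_j>1$ for all $j\le p$. Then \[ N(CB(\mathbf m))=\Bigl(\prod_{j=1}^k e_j\Bigr)F(\mathbf m_e)+\Bigl(\prod_{j=1}^{\ell} o_j\Bigr)N\Bigl(\bigl(\vee_{j=1}^k C_{e_j}\bigr)\vee\bigl(\vee_{j=1}^p C_{o_j-1}\bigr)\Bigr), \] for every choice of the identified vertices in the iterated wedge. -/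

import Mathlib

open scoped BigOperators

namespace SymEdge

universe u v w

/-- A facet of a polytope `P` in `V → ℝ`: a nonempty face (the set where a linear functional is
maximal on `P`) whose dimension is one less than the dimension of `P`. -/
def IsFacet {V : Type u} (P F : Set (V → ℝ)) : Prop :=
  F.Nonempty ∧ IsExposed ℝ P F ∧
    Module.finrank ℝ (vectorSpan ℝ F) + 1 = Module.finrank ℝ (vectorSpan ℝ P)

open Classical in
/-- The symmetric edge polytope of a graph: the convex hull of the vectors `± (e_i - e_j)` over
all edges `{i, j}` (both signs occur because adjacency is symmetric). -/
noncomputable def symmetricEdgePolytope {V : Type u} (G : SimpleGraph V) : Set (V → ℝ) :=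
  convexHull ℝ {x | ∃ i j : V, G.Adj i j ∧ x = Pi.single i (1 : ℝ) - Pi.single j (1 : ℝ)}

/-- `N(G)`: the number of facets of the symmetric edge polytope of `G`. -/
noncomputable def facetCount {V : Type u} (G : SimpleGraph V) : ℕ :=
  {F : Set (V → ℝ) | IsFacet (symmetricEdgePolytope G) F}.ncard

/-- The vertices of `CB(m)`: two endpoints (`Sum.inl false` and `Sum.inl true`) and, for each `i`,
the `m i - 1` internal vertices of the `i`-th path. -/
abbrev CBVertex {t : ℕ} (m : Fin t → ℕ) : Type :=
  Bool ⊕ (Σ i : Fin t, Fin (m i - 1))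

/-- The vertex at distance `p` from the first endpoint along the `i`-th path, `0 ≤ p ≤ m i`. -/
def cbPathVertex {t : ℕ} (m : Fin t → ℕ) (i : Fin t) (p : ℕ) : CBVertex m :=
  if p = 0 then Sum.inl false
  else if h : p - 1 < m i - 1 then Sum.inr ⟨i, ⟨p - 1, h⟩⟩
  else Sum.inl true

/-- The graph `CB(m)`: internally disjoint paths of lengths `m i ≥ 1` joining two endpoints.
Several paths of length one all contribute the same edge between the endpoints. -/
def CB {t : ℕ} (m : Fin t → ℕ) : SimpleGraph (CBVertex m) :=
  SimpleGraph.fromRel fun x y =>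
    ∃ (i : Fin t) (p : ℕ), p < m i ∧ x = cbPathVertex m i p ∧ y = cbPathVertex m i (p + 1)

/-- `F(m)`, for a vector whose entries have the same parity, with `⨅ i, m i` the smallest entry.
The factor of a smallest entry is `(⨅ i, m i).choose j`. -/
noncomputable def F {t : ℕ} (m : Fin t → ℕ) : ℕ :=
  ∑ j ∈ Finset.range ((⨅ i, m i) + 1), ∏ k, (m k).choose ((m k - ⨅ i, m i) / 2 + j)

/-- For a weakly decreasing vector, `F` in terms of the last entry. -/
theorem F_of_antitone {t : ℕ} (m : Fin (t + 1) → ℕ) (hm : Antitone m) :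
    F m = ∑ j ∈ Finset.range (m (Fin.last t) + 1), (m (Fin.last t)).choose j *
      ∏ k : Fin t, (m k.castSucc).choose ((m k.castSucc - m (Fin.last t)) / 2 + j) := by
  have h : (⨅ i, m i) = m (Fin.last t) :=
    le_antisymm (ciInf_le (OrderBot.bddBelow _) _) (le_ciInf fun i => hm (Fin.le_last i))
  unfold F
  rw [h]
  refine Finset.sum_congr rfl fun j _ => ?_
  rw [Fin.prod_univ_castSucc, mul_comm]
  simp

/-- `m_e`: subtract `1` from every even entry. -/
def subEven {t : ℕ} (m : Fin t → ℕ) (i : Fin t) : ℕ := if Even (m i) then m i - 1 else m i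

/-- `m_o`: subtract `1` from every odd entry. -/
def subOdd {t : ℕ} (m : Fin t → ℕ) (i : Fin t) : ℕ := if Odd (m i) then m i - 1 else m i

/-- `W` is a wedge `G ∨ H`: it is obtained from `G` and `H` by identifying some vertex of `G` with
some vertex of `H`. -/
def IsWedge {A : Type u} {B : Type v} {V : Type w}
    (G : SimpleGraph A) (H : SimpleGraph B) (W : SimpleGraph V) : Prop :=
  ∃ (f : A ↪ V) (g : B ↪ V), (∃ x, Set.range f ∩ Set.range g = {x}) ∧
    Set.range f ∪ Set.range g = Set.univ ∧ W = G.map f ⊔ H.map g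

/-- `W` is an iterated wedge of cycles whose lengths form the multiset `s`, with an arbitrary choice
of the identified vertices at every step. The two-cycle `SimpleGraph.cycleGraph 2` is a single
edge. -/
inductive IsWedgeOfCycles : Multiset ℕ → {V : Type u} → SimpleGraph V → Prop
  | cycle {V : Type u} (n : ℕ) (W : SimpleGraph V) (h : Nonempty (W ≃g SimpleGraph.cycleGraph n)) :
      IsWedgeOfCycles {n} W
  | wedge {A B V : Type u} {s s' : Multiset ℕ} (G : SimpleGraph A) (H : SimpleGraph B)
      (W : SimpleGraph V) (hG : IsWedgeOfCycles s G) (hH : IsWedgeOfCycles s' H)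
      (hW : IsWedge G H W) : IsWedgeOfCycles (s + s') W

/-- Any two graphs with at least one vertex have a wedge. -/
theorem exists_isWedge {A B : Type u} (G : SimpleGraph A) (H : SimpleGraph B) (a : A) (b : B) :
    ∃ (V : Type u) (W : SimpleGraph V), Nonempty V ∧ IsWedge G H W := by
  classical
  let f : A ↪ A ⊕ {y : B // y ≠ b} := ⟨Sum.inl, Sum.inl_injective⟩
  let g : B ↪ A ⊕ {y : B // y ≠ b} :=
    ⟨fun y => if h : y = b then Sum.inl a else Sum.inr ⟨y, h⟩, by
      intro y z hyz
      by_cases hy : y = b <;> by_cases hz : z = b <;> simp_all⟩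
  have hgb : g b = Sum.inl a := by simp [g]
  refine ⟨_, G.map f ⊔ H.map g, ⟨Sum.inl a⟩, f, g, ⟨Sum.inl a, ?_⟩, ?_, rfl⟩
  · ext x
    constructor
    · rintro ⟨⟨y, rfl⟩, z, hz⟩
      by_cases h : z = b
      · subst h
        rw [hgb] at hz
        exact hz.symm
      · simp [f, g, h] at hz
    · rintro rfl
      exact ⟨⟨a, rfl⟩, b, hgb⟩
  · ext x
    simp only [Set.mem_union, Set.mem_univ, iff_true]
    rcases x with x | ⟨y, hy⟩
    · exact Or.inl ⟨x, rfl⟩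
    · exact Or.inr ⟨y, by simp [g, hy]⟩

/-- Every nonempty multiset of positive lengths has a wedge of cycles. -/
theorem exists_isWedgeOfCycles (s : Multiset ℕ) (hs : s ≠ 0) (hpos : ∀ n ∈ s, 1 ≤ n) :
    ∃ (V : Type u) (W : SimpleGraph V), Nonempty V ∧ IsWedgeOfCycles s W := by
  have hc : ∀ n : ℕ, 1 ≤ n → ∃ (V : Type u) (W : SimpleGraph V), Nonempty V ∧
      IsWedgeOfCycles {n} W := fun n hn =>
    ⟨ULift.{u} (Fin n), (SimpleGraph.cycleGraph n).comap ULift.down, ⟨⟨⟨0, hn⟩⟩⟩,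
      .cycle n _ ⟨⟨Equiv.ulift, Iff.rfl⟩⟩⟩
  induction s using Multiset.induction_on with
  | empty => exact absurd rfl hs
  | cons n s ih =>
    obtain ⟨A, G, ⟨a⟩, hG⟩ := hc n (hpos n (Multiset.mem_cons_self n s))
    by_cases h : s = 0
    · subst h
      exact ⟨A, G, ⟨a⟩, hG⟩
    · obtain ⟨B, H, ⟨b⟩, hH⟩ := ih h fun k hk => hpos k (Multiset.mem_cons_of_mem hk)
      obtain ⟨V, W, hV, hW⟩ := exists_isWedge G H a b
      exact ⟨V, W, hV, by simpa using IsWedgeOfCycles.wedge G H W hG hH hW⟩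

end SymEdge

/-!
A facet of the symmetric edge polytope of a connected graph `G` lies in a hyperplane `l = 1`, where
`l` is given by a function on the vertices that is unique up to a constant. The face cut out by such
a function `f` has codimension one exactly when the tight edges, those along which `f` changes by
exactly one, connect all vertices; in particular `f` can be taken integral. Hence the facets are
counted by `facetFunctions` (`facetCount_eq_ncard`).

On `CB(m)` a facet function is the same as a family of step sequences along the paths, with entries
in `{-1, 0, 1}` and a common sum `h` (`facetCount_CB`). Two zeros on one path would cut off the
vertices between them, and a zero on every path would separate the two endpoints; otherwise the
tight edges connect the graph. A sequence of length `n` with sum `h` and at most one zero has no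
zero if `n` and `h` have the same parity, and exactly one zero, at any of `n` positions, if not. So
the paths of one parity contribute numbers of `±1` sequences, and those of the other parity
contribute a factor `n` as well; when both parities occur, some path has no zero automatically.
Summing over the odd and over the even values of `h` gives the two terms of the formula
(`prod_card_stepSeqs`, `sum_prod_signCount`, `facetCount_CB_of_mixed`). This argument does not
distinguish paths of length one, even though several of them share their only edge.

If some path has length one, then the second `F` has a single term, the product of the central
binomial coefficients `n.choose (n / 2)` of the entries `n` of `subOdd m`. These are the numbers of
facets for even cycles, and the number of facets is multiplicative over wedges, because facet
functions on the two parts that vanish at the identified vertex are glued uniquely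
(`facetCount_of_isWedgeOfCycles`). An even cycle of length `n` is treated as `CB ![n - 1, 1]`, which
also covers the single edge for `n = 2`.
-/

namespace SymEdge

/-! ### Facets of the convex hull of a symmetric set -/

section SymmetricHull

variable {E : Type*} [AddCommGroup E] [Module ℝ E]

/-- A point of `convexHull ℝ S` on a supporting hyperplane `l = 1` is a combination of the points
of `S` on that hyperplane. -/
theorem mem_span_of_mem_convexHull_of_eq_one {S : Set E} (l : E →ₗ[ℝ] ℝ) (hl : ∀ x ∈ S, l x ≤ 1)
    {x : E} (hx : x ∈ convexHull ℝ S) :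
    l x ≤ 1 ∧ (l x = 1 → x ∈ Submodule.span ℝ {y ∈ S | l y = 1}) := by
  -- The set of points with the asserted property is convex and contains `S`.
  refine convexHull_min (t := {x | l x ≤ 1 ∧ (l x = 1 → x ∈ Submodule.span ℝ {y ∈ S | l y = 1})})
    (fun y hy => ⟨hl y hy, fun h => Submodule.subset_span ⟨hy, h⟩⟩) ?_ hx
  intro y hy z hz a b ha hb hab
  have hval : l (a • y + b • z) = a * l y + b * l z := by simp
  have h1 : l y ≤ 1 := hy.1
  have h2 : l z ≤ 1 := hz.1
  refine ⟨by rw [hval]; nlinarith, fun h => ?_⟩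
  rw [hval] at h
  refine Submodule.add_mem _ ?_ ?_
  · rcases ha.eq_or_lt with rfl | ha
    · simp
    · exact Submodule.smul_mem _ _ (hy.2 (by nlinarith))
  · rcases hb.eq_or_lt with rfl | hb
    · simp
    · exact Submodule.smul_mem _ _ (hz.2 (by nlinarith))

theorem neg_mem_convexHull {S : Set E} (hS : ∀ x ∈ S, -x ∈ S) {x : E}
    (hx : x ∈ convexHull ℝ S) : -x ∈ convexHull ℝ S := by
  have h : -S = S := by
    ext y
    exact ⟨fun hy => by simpa using hS _ hy, fun hy => by simpa using hS _ hy⟩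
  rw [← h, convexHull_neg]
  simpa using hx

theorem vectorSpan_convexHull_of_symmetric {S : Set E} (hS : ∀ x ∈ S, -x ∈ S) :
    vectorSpan ℝ (convexHull ℝ S) = Submodule.span ℝ S := by
  rw [← direction_affineSpan, affineSpan_convexHull, direction_affineSpan]
  apply le_antisymm
  · rw [vectorSpan_def, Submodule.span_le]
    rintro _ ⟨x, hx, y, hy, rfl⟩
    exact Submodule.sub_mem _ (Submodule.subset_span hx) (Submodule.subset_span hy)
  · rw [Submodule.span_le]
    intro x hx
    have h := vsub_mem_vectorSpan ℝ hx (hS x hx)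
    have h2 : x = (2⁻¹ : ℝ) • (x -ᵥ (-x)) := by
      rw [vsub_eq_sub, sub_neg_eq_add, ← two_smul ℝ x, smul_smul]
      norm_num
    rw [h2]
    exact Submodule.smul_mem _ _ h

/-- A set on an affine hyperplane missing the origin has linear span of dimension one more than its
vector span. -/
theorem finrank_vectorSpan_add_one [FiniteDimensional ℝ E] {T : Set E} (l : E →ₗ[ℝ] ℝ)
    (hl : ∀ x ∈ T, l x = 1) (hT : T.Nonempty) :
    Module.finrank ℝ (vectorSpan ℝ T) + 1 = Module.finrank ℝ (Submodule.span ℝ T) := by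
  obtain ⟨p, hp⟩ := hT
  have hker : vectorSpan ℝ T ≤ LinearMap.ker l := by
    rw [vectorSpan_def, Submodule.span_le]
    rintro _ ⟨x, hx, y, hy, rfl⟩
    simp [hl x hx, hl y hy]
  have hpn : p ∉ vectorSpan ℝ T := fun h => by
    have := hker h
    rw [LinearMap.mem_ker, hl p hp] at this
    exact one_ne_zero this
  suffices h : vectorSpan ℝ T ⊔ Submodule.span ℝ {p} = Submodule.span ℝ T by
    rw [← h, Submodule.finrank_sup_span_singleton hpn]
  apply le_antisymm
  · apply sup_le
    · rw [vectorSpan_def, Submodule.span_le]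
      rintro _ ⟨x, hx, y, hy, rfl⟩
      exact Submodule.sub_mem _ (Submodule.subset_span hx) (Submodule.subset_span hy)
    · rw [Submodule.span_le, Set.singleton_subset_iff]
      exact Submodule.subset_span hp
  · rw [Submodule.span_le]
    intro x hx
    have h : x = (x -ᵥ p) + p := by simp
    rw [h]
    exact Submodule.add_mem_sup (vsub_mem_vectorSpan ℝ hx hp) (Submodule.mem_span_singleton_self p)

/-- A face in a supporting hyperplane `l = 1` has codimension one exactly when the generators on it
span the same space as all generators. -/
theorem finrank_face_add_one_iff [FiniteDimensional ℝ E] {S : Set E} (hS : ∀ x ∈ S, -x ∈ S)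
    (l : E →ₗ[ℝ] ℝ) (hl : ∀ x ∈ S, l x ≤ 1) (hne : {x ∈ convexHull ℝ S | l x = 1}.Nonempty) :
    Module.finrank ℝ (vectorSpan ℝ {x ∈ convexHull ℝ S | l x = 1}) + 1 =
        Module.finrank ℝ (vectorSpan ℝ (convexHull ℝ S)) ↔
      S ⊆ Submodule.span ℝ {x ∈ S | l x = 1} := by
  rw [finrank_vectorSpan_add_one l (fun x hx => hx.2) hne, vectorSpan_convexHull_of_symmetric hS]
  have hspan : Submodule.span ℝ {x ∈ convexHull ℝ S | l x = 1} =
      Submodule.span ℝ {x ∈ S | l x = 1} := by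
    apply le_antisymm
    · rw [Submodule.span_le]
      exact fun x hx => (mem_span_of_mem_convexHull_of_eq_one l hl hx.1).2 hx.2
    · exact Submodule.span_mono fun x hx => ⟨subset_convexHull ℝ S hx.1, hx.2⟩
  rw [hspan, ← Submodule.span_le]
  have hle : Submodule.span ℝ {x ∈ S | l x = 1} ≤ Submodule.span ℝ S :=
    Submodule.span_mono fun x hx => hx.1
  constructor
  · intro h
    exact (Submodule.eq_of_le_of_finrank_eq hle h).ge
  · intro h
    rw [le_antisymm hle h]

end SymmetricHull

/-! ### Facets of the symmetric edge polytope as functions on the vertices -/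

section FacetFunctions

variable {V : Type*}

/-- The edges of `G` along which `f` changes by exactly one. -/
def Tight (G : SimpleGraph V) (f : V → ℤ) (i j : V) : Prop :=
  G.Adj i j ∧ |f i - f j| = 1

theorem Tight.symm {G : SimpleGraph V} {f : V → ℤ} {i j : V} (h : Tight G f i j) :
    Tight G f j i :=
  ⟨h.1.symm, by rw [abs_sub_comm]; exact h.2⟩

theorem reflTransGen_tight_symm {G : SimpleGraph V} {f : V → ℤ} {i j : V}
    (h : Relation.ReflTransGen (Tight G f) i j) : Relation.ReflTransGen (Tight G f) j i := by
  induction h with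
  | refl => exact .refl
  | tail _ hbc ih => exact ih.head hbc.symm

/-- The integer functions, normalized to vanish at `v₀`, that change by at most one along the edges
of `G` and whose tight edges connect all vertices (expressed by reachability from `v₀`). -/
def facetFunctions (G : SimpleGraph V) (v₀ : V) : Set (V → ℤ) :=
  {f | f v₀ = 0 ∧ (∀ i j, G.Adj i j → |f i - f j| ≤ 1) ∧
    ∀ v, Relation.ReflTransGen (Tight G f) v₀ v}

open Classical in
/-- The vector `e_i - e_j`. -/
noncomputable def edgeVector (i j : V) : V → ℝ :=
  Pi.single i (1 : ℝ) - Pi.single j (1 : ℝ)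

/-- The generators `± (e_i - e_j)` of the symmetric edge polytope. -/
def edgeVectors (G : SimpleGraph V) : Set (V → ℝ) :=
  {x | ∃ i j : V, G.Adj i j ∧ x = edgeVector i j}

theorem neg_edgeVector (i j : V) : -edgeVector i j = edgeVector j i := by
  simp [edgeVector]

theorem edgeVector_add (i j k : V) : edgeVector i j + edgeVector j k = edgeVector i k := by
  simp [edgeVector]

theorem neg_mem_edgeVectors (G : SimpleGraph V) : ∀ x ∈ edgeVectors G, -x ∈ edgeVectors G := by
  rintro _ ⟨i, j, h, rfl⟩
  exact ⟨j, i, h.symm, neg_edgeVector i j⟩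

/-- The linear functional `x ↦ ∑ i, φ i * x i`. -/
noncomputable def functional [Fintype V] (φ : V → ℝ) : StrongDual ℝ (V → ℝ) :=
  ∑ i, φ i • ContinuousLinearMap.proj (R := ℝ) (φ := fun _ : V => ℝ) i

theorem functional_edgeVector [Fintype V] (φ : V → ℝ) (i j : V) :
    functional φ (edgeVector i j) = φ i - φ j := by
  classical
  simp [functional, edgeVector, mul_sub, Finset.sum_sub_distrib,
    Pi.single_apply]

/-- The face of the symmetric edge polytope cut out by `f`. -/
def faceOf [Fintype V] (G : SimpleGraph V) (f : V → ℤ) : Set (V → ℝ) :=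
  {x ∈ symmetricEdgePolytope G | functional (fun i => (f i : ℝ)) x = 1}

theorem functional_le_one [Fintype V] {G : SimpleGraph V} {f : V → ℤ}
    (hf : ∀ i j, G.Adj i j → |f i - f j| ≤ 1) :
    ∀ x ∈ edgeVectors G, functional (fun i => (f i : ℝ)) x ≤ 1 := by
  rintro _ ⟨i, j, h, rfl⟩
  rw [functional_edgeVector]
  exact_mod_cast (abs_le.mp (hf i j h)).2

theorem functional_edgeVector_eq_one [Fintype V] {f : V → ℤ} {i j : V} :
    functional (fun i => (f i : ℝ)) (edgeVector i j) = 1 ↔ f i - f j = 1 := by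
  rw [functional_edgeVector]
  exact_mod_cast Iff.rfl

theorem exists_tight_of_mem_facetFunctions [Nontrivial V] {G : SimpleGraph V} {v₀ : V}
    {f : V → ℤ} (hf : f ∈ facetFunctions G v₀) : ∃ i j, G.Adj i j ∧ f i - f j = 1 := by
  obtain ⟨v, hv⟩ := exists_ne v₀
  rcases Relation.ReflTransGen.cases_head (hf.2.2 v) with h | ⟨w, hw, -⟩
  · exact absurd h.symm hv
  · rcases (abs_eq zero_le_one).mp hw.2 with h | h
    · exact ⟨_, _, hw.1, h⟩
    · exact ⟨_, _, hw.1.symm, by omega⟩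

theorem isFacet_faceOf [Fintype V] [Nontrivial V] {G : SimpleGraph V} {v₀ : V}
    {f : V → ℤ} (hf : f ∈ facetFunctions G v₀) :
    IsFacet (symmetricEdgePolytope G) (faceOf G f) := by
  set l := functional (fun i => (f i : ℝ)) with hl
  obtain ⟨i, j, hij, hf1⟩ := exists_tight_of_mem_facetFunctions hf
  have hle := functional_le_one hf.2.1
  have hP : ∀ x ∈ symmetricEdgePolytope G, l x ≤ 1 := fun x hx =>
    (mem_span_of_mem_convexHull_of_eq_one l.toLinearMap hle hx).1
  have hmem : edgeVector i j ∈ symmetricEdgePolytope G := subset_convexHull _ _ ⟨i, j, hij, rfl⟩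
  have hval : l (edgeVector i j) = 1 := functional_edgeVector_eq_one.mpr hf1
  have hne : (faceOf G f).Nonempty := ⟨_, hmem, hval⟩
  refine ⟨hne, fun _ => ⟨l, ?_⟩, ?_⟩
  · ext x
    constructor
    · rintro ⟨hx, hx1⟩
      exact ⟨hx, fun y hy => (hP y hy).trans hx1.ge⟩
    · rintro ⟨hx, hx1⟩
      exact ⟨hx, le_antisymm (hP x hx) (hval ▸ hx1 _ hmem)⟩
  · refine (finrank_face_add_one_iff (neg_mem_edgeVectors G) l.toLinearMap hle hne).mpr ?_
    set U := Submodule.span ℝ {x ∈ edgeVectors G | l.toLinearMap x = 1}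
    have hreach : ∀ v, edgeVector v₀ v ∈ U := fun v => by
      induction hf.2.2 v with
      | refl => simp [edgeVector]
      | @tail b c _ hbc ih =>
        rw [← edgeVector_add v₀ b c]
        refine U.add_mem ih ?_
        rcases (abs_eq zero_le_one).mp hbc.2 with h | h
        · exact Submodule.subset_span ⟨⟨b, c, hbc.1, rfl⟩, functional_edgeVector_eq_one.mpr h⟩
        · rw [← neg_edgeVector]
          exact U.neg_mem (Submodule.subset_span
            ⟨⟨c, b, hbc.1.symm, rfl⟩, functional_edgeVector_eq_one.mpr (by omega)⟩)
    rintro _ ⟨a, b, -, rfl⟩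
    rw [← edgeVector_add a v₀ b, ← neg_edgeVector]
    exact U.add_mem (U.neg_mem (hreach a)) (hreach b)

theorem faceOf_injOn [Fintype V] (G : SimpleGraph V) (v₀ : V) :
    Set.InjOn (faceOf G) (facetFunctions G v₀) := by
  intro f hf g hg hfg
  have hstep : ∀ i j, G.Adj i j → f i - f j = 1 → g i - g j = 1 := fun i j hij h => by
    have : edgeVector i j ∈ faceOf G f :=
      ⟨subset_convexHull _ _ ⟨i, j, hij, rfl⟩, functional_edgeVector_eq_one.mpr h⟩
    rw [hfg] at this
    exact functional_edgeVector_eq_one.mp this.2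
  funext v
  induction hf.2.2 v with
  | refl => rw [hf.1, hg.1]
  | tail _ hbc ih =>
    rcases (abs_eq zero_le_one).mp hbc.2 with h | h
    · have := hstep _ _ hbc.1 h
      omega
    · have := hstep _ _ hbc.1.symm (by omega)
      omega

/-- Every facet lies in a hyperplane `l = 1` on which the polytope is supported: the facet's
functional cannot vanish at its maximum, since then the face would be the whole polytope. -/
theorem IsFacet.exists_supporting [Fintype V] {G : SimpleGraph V} {T : Set (V → ℝ)}
    (hT : IsFacet (symmetricEdgePolytope G) T) :
    ∃ l : StrongDual ℝ (V → ℝ), (∀ x ∈ symmetricEdgePolytope G, l x ≤ 1) ∧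
      T = {x ∈ symmetricEdgePolytope G | l x = 1} := by
  obtain ⟨⟨x₀, hx₀⟩, hexp, hdim⟩ := hT
  obtain ⟨l, hl⟩ := hexp ⟨x₀, hx₀⟩
  have hx₀' := hx₀
  rw [hl] at hx₀'
  obtain ⟨hxP, hmax⟩ := hx₀'
  have hneg : ∀ x ∈ symmetricEdgePolytope G, -x ∈ symmetricEdgePolytope G := fun x hx =>
    neg_mem_convexHull (neg_mem_edgeVectors G) hx
  have hc0 : 0 ≤ l x₀ := by
    have := hmax _ (hneg _ hxP)
    rw [map_neg] at this
    linarith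
  have hc : 0 < l x₀ := by
    refine lt_of_le_of_ne hc0 fun h0 => ?_
    have hTP : T = symmetricEdgePolytope G := by
      rw [hl]
      ext x
      refine ⟨fun hx => hx.1, fun hx => ⟨hx, fun y hy => ?_⟩⟩
      have h1 := hmax y hy
      have h2 := hmax _ (hneg x hx)
      rw [map_neg] at h2
      linarith
    rw [hTP] at hdim
    omega
  refine ⟨(l x₀)⁻¹ • l, fun x hx => ?_, ?_⟩
  · have := hmax x hx
    simp only [smul_apply, smul_eq_mul]
    rw [inv_mul_le_iff₀ hc]
    linarith
  · rw [hl]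
    ext x
    simp only [Set.mem_ofPred_eq, smul_apply, smul_eq_mul]
    refine and_congr_right fun hx => ?_
    rw [inv_mul_eq_one₀ hc.ne']
    exact ⟨fun h => le_antisymm (h _ hxP) (hmax x hx), fun h y hy => h ▸ hmax y hy⟩

theorem exists_mem_facetFunctions_of_isFacet [Fintype V] {G : SimpleGraph V} (hG : G.Connected)
    (v₀ : V) {T : Set (V → ℝ)} (hT : IsFacet (symmetricEdgePolytope G) T) :
    ∃ f ∈ facetFunctions G v₀, faceOf G f = T := by
  classical
  obtain ⟨l, hlP, rfl⟩ := hT.exists_supporting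
  have hlS : ∀ x ∈ edgeVectors G, l x ≤ 1 := fun x hx => hlP x (subset_convexHull _ _ hx)
  have hspan := (finrank_face_add_one_iff (neg_mem_edgeVectors G) l.toLinearMap hlS hT.1).mp
    hT.2.2
  let φ : V → ℝ := fun i => l (Pi.single i 1) - l (Pi.single v₀ 1)
  have hφ : ∀ i j, l (edgeVector i j) = φ i - φ j := fun i j => by
    simp only [edgeVector, map_sub, φ, sub_sub_sub_cancel_right]
  have hle : ∀ i j, G.Adj i j → |φ i - φ j| ≤ 1 := fun i j hij => by
    rw [abs_le]
    have h1 := hlS _ ⟨i, j, hij, rfl⟩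
    have h2 := hlS _ ⟨j, i, hij.symm, rfl⟩
    rw [hφ] at h1 h2
    constructor <;> linarith
  let R : V → V → Prop := fun i j => G.Adj i j ∧ |φ i - φ j| = 1
  -- The indicator of the tight component of `v₀` vanishes on the tight edge vectors, hence on all
  -- edge vectors, so it is constant on the connected graph `G`.
  have hreach : ∀ v, Relation.ReflTransGen R v₀ v := by
    let χ : V → ℝ := fun v => if Relation.ReflTransGen R v₀ v then 1 else 0
    have hχR : ∀ i j, R i j → χ i = χ j := fun i j hij => by
      have hji : R j i := ⟨hij.1.symm, by rw [abs_sub_comm]; exact hij.2⟩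
      have : Relation.ReflTransGen R v₀ i ↔ Relation.ReflTransGen R v₀ j :=
        ⟨fun h => h.tail hij, fun h => h.tail hji⟩
      simp only [χ, this]
    have hker : Submodule.span ℝ {x ∈ edgeVectors G | l.toLinearMap x = 1} ≤
        LinearMap.ker (functional χ).toLinearMap := by
      rw [Submodule.span_le]
      rintro _ ⟨⟨i, j, hij, rfl⟩, h1⟩
      have h1' : l (edgeVector i j) = 1 := h1
      rw [hφ] at h1'
      have : functional χ (edgeVector i j) = 0 := by
        rw [functional_edgeVector, hχR i j ⟨hij, by rw [h1', abs_one]⟩, sub_self]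
      exact this
    have hadj : ∀ i j, G.Adj i j → χ i = χ j := fun i j hij => by
      have h : functional χ (edgeVector i j) = 0 := hker (hspan ⟨i, j, hij, rfl⟩)
      rw [functional_edgeVector] at h
      linarith
    intro v
    have hv : χ v₀ = χ v := by
      have := (SimpleGraph.reachable_iff_reflTransGen v₀ v).mp (hG.preconnected v₀ v)
      induction this with
      | refl => rfl
      | tail _ hbc ih => rw [ih, hadj _ _ hbc]
    by_contra hcon
    simp [χ, hcon, Relation.ReflTransGen.refl] at hv
  have hint : ∀ v, ∃ n : ℤ, (n : ℝ) = φ v := fun v => by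
    induction hreach v with
    | refl => exact ⟨0, by simp [φ]⟩
    | tail _ hbc ih =>
      obtain ⟨n, hn⟩ := ih
      rcases (abs_eq zero_le_one).mp hbc.2 with h | h
      · exact ⟨n - 1, by push_cast; linarith⟩
      · exact ⟨n + 1, by push_cast; linarith⟩
  choose f hf using hint
  have hfφ : (fun i => (f i : ℝ)) = φ := funext hf
  refine ⟨f, ⟨?_, fun i j hij => ?_, fun v => Relation.ReflTransGen.mono ?_ _ _ (hreach v)⟩, ?_⟩
  · have : (f v₀ : ℝ) = 0 := by rw [hf]; simp [φ]
    exact_mod_cast this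
  · have := hle i j hij
    rw [← hf, ← hf] at this
    exact_mod_cast this
  · rintro i j ⟨hij, h⟩
    refine ⟨hij, ?_⟩
    rw [← hf, ← hf] at h
    exact_mod_cast h
  · -- The functionals `l` and `functional φ` agree on the polytope, which spans the edge vectors.
    have hagree : ∀ x ∈ symmetricEdgePolytope G, functional (fun i => (f i : ℝ)) x = l x := by
      intro x hx
      rw [hfφ]
      refine convexHull_min (t := {x | functional φ x = l x}) ?_ ?_ hx
      · rintro _ ⟨i, j, -, rfl⟩
        show functional φ (edgeVector i j) = l (edgeVector i j)
        rw [functional_edgeVector, hφ]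
      · intro y hy z hz a b _ _ _
        have hy' : functional φ y = l y := hy
        have hz' : functional φ z = l z := hz
        show functional φ _ = l _
        simp [hy', hz']
    ext x
    exact and_congr_right fun hx => by rw [hagree x hx]

/-- The facets of the symmetric edge polytope of a connected graph correspond to the facet
functions. -/
theorem facetCount_eq_ncard [Finite V] [Nontrivial V] {G : SimpleGraph V} (hG : G.Connected)
    (v₀ : V) : facetCount G = (facetFunctions G v₀).ncard := by
  have := Fintype.ofFinite V
  rw [← (faceOf_injOn G v₀).ncard_image, facetCount]
  congr 1
  ext T
  constructor
  · exact fun hT => exists_mem_facetFunctions_of_isFacet hG v₀ hT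
  · rintro ⟨f, hf, rfl⟩
    exact isFacet_faceOf hf

end FacetFunctions

/-! ### The paths of `CB(m)` -/

section Paths

variable {t : ℕ} {m : Fin t → ℕ}

theorem cbPathVertex_zero (i : Fin t) : cbPathVertex m i 0 = Sum.inl false := by
  simp [cbPathVertex]

theorem cbPathVertex_end (i : Fin t) (h : 1 ≤ m i) : cbPathVertex m i (m i) = Sum.inl true := by
  have h0 : m i ≠ 0 := by omega
  simp [cbPathVertex, h0]

theorem cbPathVertex_inner (i : Fin t) (p : Fin (m i - 1)) :
    cbPathVertex m i (p + 1) = Sum.inr ⟨i, p⟩ := by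
  simp [cbPathVertex]

/-- Below the second endpoint the position on a path is determined by the vertex, and so is the path
except at the first endpoint. -/
theorem cbPathVertex_inj {i i' : Fin t} {p p' : ℕ} (hp : p < m i) (hp' : p' ≤ m i')
    (h : cbPathVertex m i' p' = cbPathVertex m i p) : p' = p ∧ (p = 0 ∨ i' = i) := by
  rcases Nat.eq_zero_or_pos p with rfl | hp0 <;> rcases Nat.eq_zero_or_pos p' with rfl | hp0'
  · exact ⟨rfl, Or.inl rfl⟩
  · unfold cbPathVertex at h
    split_ifs at h <;> first | omega | simp at h
  · unfold cbPathVertex at h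
    split_ifs at h <;> omega
  · have h1 : p ≠ 0 := by omega
    have h2 : p' ≠ 0 := by omega
    have h3 : p - 1 < m i - 1 := by omega
    simp only [cbPathVertex, h1, h2, h3, if_false, dif_pos] at h
    split_ifs at h with h4
    simp only [Sum.inr.injEq, Sigma.mk.injEq] at h
    obtain ⟨rfl, h⟩ := h
    have := congrArg Fin.val (eq_of_heq h)
    simp only at this
    exact ⟨by omega, Or.inr rfl⟩

theorem CB_adj_iff {x y : CBVertex m} :
    (CB m).Adj x y ↔ ∃ (i : Fin t) (p : ℕ), p < m i ∧
      (x = cbPathVertex m i p ∧ y = cbPathVertex m i (p + 1) ∨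
        y = cbPathVertex m i p ∧ x = cbPathVertex m i (p + 1)) := by
  have hne : ∀ (i : Fin t) (p : ℕ), p < m i → cbPathVertex m i p ≠ cbPathVertex m i (p + 1) :=
    fun i p hp h => by
      have := (cbPathVertex_inj hp hp h.symm).1
      omega
  simp only [CB, SimpleGraph.fromRel_adj]
  constructor
  · rintro ⟨-, ⟨i, p, hp, hx, hy⟩ | ⟨i, p, hp, hx, hy⟩⟩
    · exact ⟨i, p, hp, Or.inl ⟨hx, hy⟩⟩
    · exact ⟨i, p, hp, Or.inr ⟨hx, hy⟩⟩
  · rintro ⟨i, p, hp, ⟨hx, hy⟩ | ⟨hx, hy⟩⟩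
    · exact ⟨hx ▸ hy ▸ hne i p hp, Or.inl ⟨i, p, hp, hx, hy⟩⟩
    · exact ⟨hx ▸ hy ▸ (hne i p hp).symm, Or.inr ⟨i, p, hp, hx, hy⟩⟩

theorem exists_eq_cbPathVertex (hpos : ∀ i, 1 ≤ m i) (i₀ : Fin t) (x : CBVertex m) :
    ∃ (i : Fin t) (p : ℕ), p ≤ m i ∧ x = cbPathVertex m i p := by
  rcases x with (_ | _) | ⟨i, p⟩
  · exact ⟨i₀, 0, Nat.zero_le _, (cbPathVertex_zero i₀).symm⟩
  · exact ⟨i₀, m i₀, le_rfl, (cbPathVertex_end i₀ (hpos i₀)).symm⟩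
  · exact ⟨i, p + 1, by omega, (cbPathVertex_inner i p).symm⟩

theorem CB_connected (hpos : ∀ i, 1 ≤ m i) (i₀ : Fin t) : (CB m).Connected := by
  have : Nonempty (CBVertex m) := ⟨Sum.inl false⟩
  have key : ∀ (i : Fin t) (p : ℕ), p ≤ m i →
      (CB m).Reachable (Sum.inl false) (cbPathVertex m i p) := by
    intro i p
    induction p with
    | zero => exact fun _ => by rw [cbPathVertex_zero]
    | succ p ih =>
      intro hp
      exact (ih (by omega)).trans
        (SimpleGraph.Adj.reachable (CB_adj_iff.mpr ⟨i, p, hp, Or.inl ⟨rfl, rfl⟩⟩))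
  have hreach : ∀ x, (CB m).Reachable (Sum.inl false) x := fun x => by
    obtain ⟨i, p, hp, rfl⟩ := exists_eq_cbPathVertex hpos i₀ x
    exact key i p hp
  exact ⟨fun x y => (hreach x).symm.trans (hreach y)⟩

/-! ### Facet functions on `CB(m)` as families of steps -/

/-- The increments of `f` along the paths of `CB(m)`. -/
def pathSteps (f : CBVertex m → ℤ) (i : Fin t) (p : Fin (m i)) : ℤ :=
  f (cbPathVertex m i (p + 1)) - f (cbPathVertex m i p)

variable (m) in
/-- Families of steps in `{-1, 0, 1}`, one sequence of length `m i` for each path, with a common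
sum, at most one zero in each sequence, and no zero in at least one sequence. -/
def stepFamilies : Set (∀ i, Fin (m i) → ℤ) :=
  {s | (∀ i p, |s i p| ≤ 1) ∧ (∀ i p p', s i p = 0 → s i p' = 0 → p = p') ∧
    (∃ h, ∀ i, ∑ p, s i p = h) ∧ ∃ i, ∀ p, s i p ≠ 0}

theorem sum_pathSteps (hpos : ∀ i, 1 ≤ m i) (f : CBVertex m → ℤ) (i : Fin t) :
    ∑ p, pathSteps f i p = f (Sum.inl true) - f (Sum.inl false) := by
  have h := Finset.sum_range_sub (fun p => f (cbPathVertex m i p)) (m i)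
  rw [cbPathVertex_end i (hpos i), cbPathVertex_zero] at h
  rw [← h, ← Fin.sum_univ_eq_sum_range
    (fun p => f (cbPathVertex m i (p + 1)) - f (cbPathVertex m i p))]
  rfl

theorem eq_of_pathSteps_eq (hpos : ∀ i, 1 ≤ m i) (i₀ : Fin t) {f g : CBVertex m → ℤ}
    (h0 : f (Sum.inl false) = g (Sum.inl false)) (h : pathSteps f = pathSteps g) : f = g := by
  have key : ∀ (i : Fin t) (p : ℕ), p ≤ m i →
      f (cbPathVertex m i p) = g (cbPathVertex m i p) := by
    intro i p
    induction p with
    | zero => exact fun _ => by rw [cbPathVertex_zero, h0]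
    | succ p ih =>
      intro hp
      have h1 := congrFun (congrFun h i) ⟨p, hp⟩
      have h2 := ih (by omega)
      simp only [pathSteps] at h1
      omega
  funext x
  obtain ⟨i, p, hp, rfl⟩ := exists_eq_cbPathVertex hpos i₀ x
  exact key i p hp

/-- Two vertices of a path with only nonzero steps between them are joined by tight edges. -/
theorem reflTransGen_tight_of_ne_zero {f : CBVertex m → ℤ}
    (hf : ∀ i p, |pathSteps f i p| ≤ 1) (i : Fin t) {a b : ℕ} (hab : a ≤ b) (hb : b ≤ m i)
    (hne : ∀ p : Fin (m i), a ≤ p → p < b → pathSteps f i p ≠ 0) :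
    Relation.ReflTransGen (Tight (CB m) f) (cbPathVertex m i a) (cbPathVertex m i b) := by
  induction b, hab using Nat.le_induction with
  | base => exact .refl
  | succ b hab ih =>
    refine (ih (by omega) fun p h1 h2 => hne p h1 (by omega)).tail
      ⟨CB_adj_iff.mpr ⟨i, b, hb, Or.inl ⟨rfl, rfl⟩⟩, ?_⟩
    have h1 := hne ⟨b, hb⟩ hab (by simp)
    have h2 := hf i ⟨b, hb⟩
    have h3 := abs_pos.mpr h1
    have h4 : |pathSteps f i ⟨b, hb⟩| = 1 := by omega
    rw [abs_sub_comm]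
    exact h4

/-- Tightness is symmetric, so a set that no tight edge leaves is not entered by one either. -/
theorem not_mem_of_reflTransGen_tight {V : Type*} {G : SimpleGraph V} {f : V → ℤ} {C : Set V}
    (hC : ∀ x y, x ∈ C → Tight G f x y → y ∈ C) {v w : V} (hv : v ∉ C)
    (h : Relation.ReflTransGen (Tight G f) v w) : w ∉ C := by
  induction h with
  | refl => exact hv
  | tail _ hbc ih => exact fun hc => ih (hC _ _ hc hbc.symm)

theorem pathSteps_mem_stepFamilies (hpos : ∀ i, 1 ≤ m i) (i₀ : Fin t) {f : CBVertex m → ℤ}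
    (hf : f ∈ facetFunctions (CB m) (Sum.inl false)) : pathSteps f ∈ stepFamilies m := by
  obtain ⟨h0, hle, hreach⟩ := hf
  -- A zero step is not tight.
  have hzero : ∀ (i : Fin t) (p : ℕ) (hp : p < m i), pathSteps f i ⟨p, hp⟩ = 0 →
      |f (cbPathVertex m i p) - f (cbPathVertex m i (p + 1))| ≠ 1 := by
    intro i p hp h h1
    rw [abs_sub_comm] at h1
    have : |pathSteps f i ⟨p, hp⟩| = 1 := h1
    rw [h] at this
    simp at this
  have hunique : ∀ (i : Fin t) (z z' : Fin (m i)), pathSteps f i z = 0 → pathSteps f i z' = 0 →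
      ¬ z < z' := by
    intro i z z' hz hz' hlt
    have hlt' : (z : ℕ) < z' := hlt
    -- The vertices strictly between two zero steps are cut off.
    let C : Set (CBVertex m) := {x | ∃ p : ℕ, (z : ℕ) < p ∧ p ≤ z' ∧ x = cbPathVertex m i p}
    have hC : ∀ x y, x ∈ C → Tight (CB m) f x y → y ∈ C := by
      rintro x y ⟨p, hp1, hp2, rfl⟩ ⟨hadj, habs⟩
      obtain ⟨i', p', hp', ⟨hx, hy⟩ | ⟨hy, hx⟩⟩ := CB_adj_iff.mp hadj
      · obtain ⟨rfl, h | rfl⟩ := cbPathVertex_inj (by omega) hp'.le hx.symm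
        · omega
        · subst hy
          have : p' ≠ z' := by
            rintro rfl
            exact hzero i' z' z'.2 hz' habs
          exact ⟨p' + 1, by omega, by omega, rfl⟩
      · obtain ⟨rfl, h | rfl⟩ := cbPathVertex_inj (by omega) hp' hx.symm
        · omega
        · subst hy
          have : p' ≠ z := by
            rintro rfl
            rw [abs_sub_comm] at habs
            exact hzero i' z z.2 hz habs
          exact ⟨p', by omega, by omega, rfl⟩
    refine not_mem_of_reflTransGen_tight hC (v := Sum.inl false) ?_
      (hreach (cbPathVertex m i z')) ⟨z', hlt', le_rfl, rfl⟩
    rintro ⟨p, hp1, hp2, h⟩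
    rw [← cbPathVertex_zero i] at h
    have := (cbPathVertex_inj (by omega) (Nat.zero_le _) h).1
    omega
  refine ⟨fun i p => ?_, fun i z z' hz hz' => ?_, ⟨_, sum_pathSteps hpos f⟩, ?_⟩
  · exact hle _ _ (CB_adj_iff.mpr ⟨i, p, p.2, Or.inr ⟨rfl, rfl⟩⟩)
  · exact le_antisymm (not_lt.mp (hunique i z' z hz' hz)) (not_lt.mp (hunique i z z' hz hz'))
  · by_contra! hcon
    choose z hz using hcon
    -- If every path has a zero step, the vertices after these steps are cut off.
    let C : Set (CBVertex m) := {x | ∃ i p, p ≤ (z i : ℕ) ∧ x = cbPathVertex m i p}ᶜ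
    have hC : ∀ x y, x ∈ C → Tight (CB m) f x y → y ∈ C := by
      rintro y x hy htight ⟨i, p, hp, rfl⟩
      have hzi := (z i).2
      refine hy ?_
      obtain ⟨hadj, habs⟩ := htight.symm
      obtain ⟨i', p', hp', ⟨hx, rfl⟩ | ⟨rfl, hx⟩⟩ := CB_adj_iff.mp hadj
      · obtain ⟨rfl, h⟩ := cbPathVertex_inj (by omega) hp'.le hx.symm
        have hle : p' ≤ z i' := by
          rcases h with rfl | rfl
          · exact Nat.zero_le _
          · exact hp
        have : p' ≠ z i' := by
          rintro rfl
          rw [hx] at habs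
          exact hzero i' _ (z i').2 (hz i') habs
        exact ⟨i', p' + 1, by omega, rfl⟩
      · obtain ⟨rfl, h | rfl⟩ := cbPathVertex_inj (by omega) hp' hx.symm
        · omega
        · exact ⟨i', p', by omega, rfl⟩
    have hmem : (Sum.inl true : CBVertex m) ∈ C := by
      rintro ⟨i, p, hp, h⟩
      have hzi := (z i).2
      rw [← cbPathVertex_end i (hpos i)] at h
      have := (cbPathVertex_inj (by omega) le_rfl h).1
      omega
    refine not_mem_of_reflTransGen_tight hC (v := Sum.inl false) (fun h => h ?_)
      (hreach (Sum.inl true)) hmem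
    exact ⟨i₀, 0, Nat.zero_le _, (cbPathVertex_zero i₀).symm⟩

theorem exists_pathSteps_eq (hpos : ∀ i, 1 ≤ m i) {s : ∀ i, Fin (m i) → ℤ}
    (hs : ∃ h, ∀ i, ∑ p, s i p = h) :
    ∃ f : CBVertex m → ℤ, f (Sum.inl false) = 0 ∧ pathSteps f = s := by
  obtain ⟨h, hh⟩ := hs
  let f : CBVertex m → ℤ := Sum.elim (fun b => if b then h else 0)
    (fun x => ∑ j : Fin (m x.1) with j.val < x.2.val + 1, s x.1 j)
  have hf : ∀ (i : Fin t) (p : ℕ), p ≤ m i →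
      f (cbPathVertex m i p) = ∑ j : Fin (m i) with j.val < p, s i j := by
    intro i p hp
    rcases Nat.eq_zero_or_pos p with rfl | hp0
    · simp [cbPathVertex_zero, f]
    rcases hp.eq_or_lt with rfl | hlt
    · rw [cbPathVertex_end i (hpos i), Finset.filter_true_of_mem fun j _ => j.2, hh]
      rfl
    · obtain ⟨p, rfl⟩ := Nat.exists_eq_succ_of_ne_zero hp0.ne'
      rw [Nat.succ_eq_add_one, cbPathVertex_inner i ⟨p, by omega⟩]
      rfl
  refine ⟨f, rfl, ?_⟩
  funext i p
  have hp := p.2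
  rw [pathSteps, hf i _ hp, hf i _ hp.le]
  have hins : (Finset.univ.filter fun j : Fin (m i) => j.val < p + 1) =
      insert p (Finset.univ.filter fun j : Fin (m i) => j.val < p) := by
    ext j
    simp only [Finset.mem_filter, Finset.mem_univ, true_and, Finset.mem_insert, Fin.ext_iff]
    omega
  rw [hins, Finset.sum_insert (by simp)]
  ring

theorem mem_facetFunctions_of_pathSteps (hpos : ∀ i, 1 ≤ m i) {f : CBVertex m → ℤ}
    (h0 : f (Sum.inl false) = 0) (hs : pathSteps f ∈ stepFamilies m) :
    f ∈ facetFunctions (CB m) (Sum.inl false) := by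
  obtain ⟨hle, huniq, -, i₀, hi₀⟩ := hs
  refine ⟨h0, fun x y hxy => ?_, fun x => ?_⟩
  · obtain ⟨i, p, hp, ⟨rfl, rfl⟩ | ⟨rfl, rfl⟩⟩ := CB_adj_iff.mp hxy
    · rw [abs_sub_comm]
      exact hle i ⟨p, hp⟩
    · exact hle i ⟨p, hp⟩
  · have hend : Relation.ReflTransGen (Tight (CB m) f) (Sum.inl false) (Sum.inl true) := by
      have := reflTransGen_tight_of_ne_zero hle i₀ (Nat.zero_le _) le_rfl
        fun p _ _ => hi₀ p
      rwa [cbPathVertex_zero, cbPathVertex_end i₀ (hpos i₀)] at this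
    obtain ⟨i, p, hp, rfl⟩ := exists_eq_cbPathVertex hpos i₀ x
    -- A vertex before the zero step of its path hangs on the first endpoint, one after it on the
    -- second.
    by_cases hz : ∃ z : Fin (m i), z.val < p ∧ pathSteps f i z = 0
    · obtain ⟨z, hzp, hz⟩ := hz
      have := reflTransGen_tight_of_ne_zero hle i hp le_rfl fun p' h1 _ h => by
        have := huniq i z p' hz h
        subst this
        omega
      rw [cbPathVertex_end i (hpos i)] at this
      exact hend.trans (reflTransGen_tight_symm this)
    · push Not at hz
      have := reflTransGen_tight_of_ne_zero hle i (Nat.zero_le _) hp fun p' _ h => hz p' h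
      rwa [cbPathVertex_zero] at this

theorem facetCount_CB (hpos : ∀ i, 1 ≤ m i) (i₀ : Fin t) :
    facetCount (CB m) = (stepFamilies m).ncard := by
  have : Nontrivial (CBVertex m) := ⟨⟨Sum.inl false, Sum.inl true, by simp⟩⟩
  rw [facetCount_eq_ncard (CB_connected hpos i₀) (Sum.inl false)]
  refine Set.ncard_congr (fun f _ => pathSteps f)
    (fun f hf => pathSteps_mem_stepFamilies hpos i₀ hf)
    (fun f g hf hg h => eq_of_pathSteps_eq hpos i₀ (hf.1.trans hg.1.symm) h) fun s hs => ?_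
  obtain ⟨f, h0, rfl⟩ := exists_pathSteps_eq hpos hs.2.2.1
  exact ⟨f, mem_facetFunctions_of_pathSteps hpos h0 hs, rfl⟩

end Paths

/-! ### Counting step sequences -/

section Counting

/-- The sequences of signs `±1` indexed by `α` with sum `h`. -/
def signSeqs (α : Type*) [Fintype α] [DecidableEq α] (h : ℤ) : Finset (α → ℤ) :=
  (Fintype.piFinset fun _ => {-1, 1}).filter fun s => ∑ x, s x = h

theorem mem_signSeqs {α : Type*} [Fintype α] [DecidableEq α] {h : ℤ} {s : α → ℤ} :
    s ∈ signSeqs α h ↔ (∀ x, s x = -1 ∨ s x = 1) ∧ ∑ x, s x = h := by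
  simp [signSeqs]

theorem sum_sign {α : Type*} [Fintype α] {s : α → ℤ} (hs : ∀ x, s x = -1 ∨ s x = 1) :
    ∑ x, s x = 2 * ((Finset.univ.filter fun x => s x = 1).card : ℤ) - Fintype.card α := by
  have : ∀ x, s x = 2 * (if s x = 1 then 1 else 0) - 1 := fun x => by
    rcases hs x with h | h <;> simp [h]
  rw [Finset.sum_congr rfl fun x _ => this x, Finset.sum_sub_distrib, ← Finset.mul_sum,
    Finset.sum_boole]
  simp

theorem card_signSeqs {α : Type*} [Fintype α] [DecidableEq α] {h : ℤ} {k : ℕ}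
    (hk : 2 * (k : ℤ) = Fintype.card α + h) :
    (signSeqs α h).card = (Fintype.card α).choose k := by
  rw [← Finset.card_univ (α := α), ← Finset.card_powersetCard]
  refine Finset.card_nbij' (fun s => Finset.univ.filter fun x => s x = 1)
    (fun T x => if x ∈ T then 1 else -1) ?_ ?_ ?_ ?_
  · intro s hs
    obtain ⟨h1, h2⟩ := mem_signSeqs.mp hs
    rw [sum_sign h1] at h2
    refine Finset.mem_powersetCard.mpr ⟨Finset.subset_univ _, ?_⟩
    show (Finset.univ.filter fun x => s x = 1).card = k
    omega
  · intro T hT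
    have hT' := (Finset.mem_powersetCard.mp hT).2
    have h1 : ∀ x, (if x ∈ T then (1 : ℤ) else -1) = -1 ∨ (if x ∈ T then (1 : ℤ) else -1) = 1 :=
      fun x => by split_ifs <;> simp
    refine mem_signSeqs.mpr ⟨h1, ?_⟩
    rw [sum_sign h1]
    have : (Finset.univ.filter fun x => (if x ∈ T then (1 : ℤ) else -1) = 1) = T := by
      ext x
      by_cases hx : x ∈ T <;> simp [hx]
    rw [this]
    omega
  · intro s hs
    funext x
    rcases (mem_signSeqs.mp hs).1 x with h | h <;> simp [h]
  · intro T _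
    ext x
    by_cases hx : x ∈ T <;> simp [hx]

theorem exists_of_mem_signSeqs {α : Type*} [Fintype α] [DecidableEq α] {h : ℤ} {s : α → ℤ}
    (hs : s ∈ signSeqs α h) : ∃ k : ℕ, k ≤ Fintype.card α ∧ 2 * (k : ℤ) = Fintype.card α + h := by
  obtain ⟨h1, h2⟩ := mem_signSeqs.mp hs
  rw [sum_sign h1] at h2
  exact ⟨(Finset.univ.filter fun x => s x = 1).card, Finset.card_le_univ _, by omega⟩

/-- The number of `±1` sequences of length `n` with sum `h`. -/
def signCount (n : ℕ) (h : ℤ) : ℕ := (signSeqs (Fin n) h).card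

theorem signCount_eq_choose {n k : ℕ} {h : ℤ} (hk : 2 * (k : ℤ) = n + h) :
    signCount n h = n.choose k := by
  rw [signCount, card_signSeqs (k := k) (by simpa using hk), Fintype.card_fin]

theorem signCount_eq_zero {n : ℕ} {h : ℤ}
    (hn : ∀ k : ℕ, k ≤ n → 2 * (k : ℤ) ≠ n + h) : signCount n h = 0 := by
  rw [signCount, Finset.card_eq_zero, Finset.eq_empty_iff_forall_notMem]
  intro s hs
  obtain ⟨k, hk, h2⟩ := exists_of_mem_signSeqs hs
  simp only [Fintype.card_fin] at hk h2
  exact hn k hk h2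

/-- The sequences of steps `-1, 0, 1` with sum `h` and at most one zero. -/
def stepSeqs (n : ℕ) (h : ℤ) : Finset (Fin n → ℤ) :=
  (Fintype.piFinset fun _ => {-1, 0, 1}).filter fun s =>
    (∀ p p', s p = 0 → s p' = 0 → p = p') ∧ ∑ p, s p = h

theorem mem_stepSeqs {n : ℕ} {h : ℤ} {s : Fin n → ℤ} :
    s ∈ stepSeqs n h ↔ (∀ p, |s p| ≤ 1) ∧ (∀ p p', s p = 0 → s p' = 0 → p = p') ∧
      ∑ p, s p = h := by
  have : ∀ x : ℤ, |x| ≤ 1 ↔ x = -1 ∨ x = 0 ∨ x = 1 := fun x => by rw [abs_le]; omega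
  simp [stepSeqs, this]

theorem signSeqs_eq_filter (n : ℕ) (h : ℤ) :
    signSeqs (Fin n) h = (stepSeqs n h).filter fun s => ∀ p, s p ≠ 0 := by
  ext s
  rw [Finset.mem_filter, mem_stepSeqs, mem_signSeqs]
  constructor
  · rintro ⟨h1, h2⟩
    have h3 : ∀ p, s p ≠ 0 := fun p => by rcases h1 p with h | h <;> omega
    exact ⟨⟨fun p => by rcases h1 p with h | h <;> simp [h], fun p _ hp => absurd hp (h3 p), h2⟩,
      h3⟩
  · rintro ⟨⟨h1, -, h2⟩, h3⟩
    refine ⟨fun p => ?_, h2⟩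
    have := abs_le.mp (h1 p)
    have := h3 p
    omega

/-- Deleting the zero at position `z` leaves a sign sequence. -/
theorem card_stepSeqs_filter_zero (n : ℕ) (h : ℤ) (z : Fin n) :
    ((stepSeqs n h).filter fun s => s z = 0).card = signCount (n - 1) h := by
  obtain ⟨n, rfl⟩ : ∃ k, n = k + 1 := ⟨n - 1, by have := z.2; omega⟩
  rw [Nat.add_sub_cancel, signCount]
  refine Finset.card_nbij' (fun s j => s (z.succAbove j)) (fun s => Fin.insertNth z 0 s) ?_ ?_ ?_ ?_
  · intro s hs
    obtain ⟨hs, hz⟩ := Finset.mem_filter.mp hs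
    obtain ⟨h1, h2, h3⟩ := mem_stepSeqs.mp hs
    refine mem_signSeqs.mpr ⟨fun j => ?_, ?_⟩
    · have h4 := abs_le.mp (h1 (z.succAbove j))
      have h5 : s (z.succAbove j) ≠ 0 := fun h0 => Fin.succAbove_ne z j (h2 _ _ h0 hz)
      show s (z.succAbove j) = -1 ∨ s (z.succAbove j) = 1
      omega
    · rw [Fin.sum_univ_succAbove _ z, hz, zero_add] at h3
      exact h3
  · intro s hs
    obtain ⟨h1, h2⟩ := mem_signSeqs.mp hs
    have hzero : ∀ p, Fin.insertNth (α := fun _ => ℤ) z 0 s p = 0 → p = z := fun p => by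
      refine Fin.succAboveCases z (fun _ => rfl) (fun j hj => ?_) p
      rw [Fin.insertNth_apply_succAbove] at hj
      rcases h1 j with h | h <;> omega
    refine Finset.mem_filter.mpr ⟨mem_stepSeqs.mpr ⟨fun p => ?_, fun p p' hp hp' => ?_, ?_⟩, ?_⟩
    · refine Fin.succAboveCases z ?_ (fun j => ?_) p
      · simp
      · show |Fin.insertNth (α := fun _ => ℤ) z 0 s (z.succAbove j)| ≤ 1
        rw [Fin.insertNth_apply_succAbove]
        rcases h1 j with h | h <;> simp [h]
    · rw [hzero p hp, hzero p' hp']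
    · rw [Fin.sum_univ_succAbove _ z]
      simpa using h2
    · simp
  · intro s hs
    obtain ⟨hs, hz⟩ := Finset.mem_filter.mp hs
    funext p
    refine Fin.succAboveCases z ?_ (fun j => ?_) p
    · simp [hz]
    · simp
  · intro s _
    funext j
    simp

theorem card_stepSeqs (n : ℕ) (h : ℤ) :
    (stepSeqs n h).card = signCount n h + n * signCount (n - 1) h := by
  rw [← Finset.card_filter_add_card_filter_not (fun s : Fin n → ℤ => ∀ p, s p ≠ 0),
    ← signSeqs_eq_filter]
  congr 1
  have hU : ((stepSeqs n h).filter fun s => ¬ ∀ p, s p ≠ 0) =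
      Finset.univ.biUnion fun z => (stepSeqs n h).filter fun s => s z = 0 := by
    ext s
    simp
  rw [hU, Finset.card_biUnion]
  · simp [card_stepSeqs_filter_zero]
  · intro z _ z' _ hne
    rw [Function.onFun, Finset.disjoint_left]
    intro s hs hs'
    obtain ⟨hs, hz⟩ := Finset.mem_filter.mp hs
    exact hne ((mem_stepSeqs.mp hs).2.1 z z' hz (Finset.mem_filter.mp hs').2)

/-- The terms of `F` are indexed by the common sum `h = 2 j - min m` of the sign sequences. -/
theorem sum_prod_signCount {t : ℕ} (m : Fin t → ℕ) (i₀ : Fin t) (hpar : ∀ i j, m i % 2 = m j % 2)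
    {M : ℕ} (hM : ∀ i, m i ≤ M) :
    ∑ h ∈ Finset.Icc (-(M : ℤ)) M, ∏ i, signCount (m i) h = F m := by
  have : Nonempty (Fin t) := ⟨i₀⟩
  obtain ⟨k, hk⟩ : ∃ k, m k = ⨅ i, m i := exists_eq_ciInf_of_finite
  have hmin : ∀ i, ⨅ i, m i ≤ m i := fun i => ciInf_le (OrderBot.bddBelow _) i
  unfold F
  rw [← hk] at hmin ⊢
  symm
  refine Finset.sum_of_injOn (fun j : ℕ => 2 * (j : ℤ) - m k) ?_ ?_ ?_ ?_
  · intro a _ b _ hab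
    simp only at hab
    omega
  · intro j hj
    have := hM k
    simp only [Finset.coe_range, Set.mem_Iio] at hj
    simp only [Finset.coe_Icc, Set.mem_Icc]
    omega
  · intro h _ hh
    refine Finset.prod_eq_zero (Finset.mem_univ k) (signCount_eq_zero fun j hj h2 => hh ?_)
    refine ⟨j, ?_, ?_⟩
    · simp only [Finset.coe_range, Set.mem_Iio]
      omega
    · simp only
      omega
  · intro j _
    refine Finset.prod_congr rfl fun i _ => (signCount_eq_choose ?_).symm
    have h1 := hmin i
    have h2 := hpar i k
    omega

end Counting

/-! ### The number of facets for `CB(m)` -/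

section FacetCountCB

variable {t : ℕ} {m : Fin t → ℕ}

theorem abs_sum_le_of_forall {n : ℕ} {s : Fin n → ℤ} (hs : ∀ p, |s p| ≤ 1) : |∑ p, s p| ≤ n :=
  (Finset.abs_sum_le_sum_abs _ _).trans ((Finset.sum_le_sum fun p _ => hs p).trans (by simp))

/-- The families of sequences with a common sum in a fixed range, selected from finite sets
`A i h`. -/
theorem card_biUnion_piFinset (A : ∀ i : Fin t, ℤ → Finset (Fin (m i) → ℤ)) (i₀ : Fin t)
    (hA : ∀ i h, ∀ s ∈ A i h, ∑ p, s p = h) (H : Finset ℤ) :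
    (H.biUnion fun h => Fintype.piFinset fun i => A i h).card =
      ∑ h ∈ H, ∏ i, (A i h).card := by
  rw [Finset.card_biUnion]
  · simp [Fintype.card_piFinset]
  · intro h _ h' _ hne
    rw [Function.onFun, Finset.disjoint_left]
    intro s hs hs'
    rw [Fintype.mem_piFinset] at hs hs'
    exact hne ((hA i₀ h _ (hs i₀)).symm.trans (hA i₀ h' _ (hs' i₀)))

/-- A sequence with exactly one zero has a sum of the parity opposite to its length. -/
theorem forall_ne_zero_or_parity_ne {n : ℕ} {h : ℤ} {s : Fin n → ℤ} (hs : s ∈ stepSeqs n h) :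
    (∀ p, s p ≠ 0) ∨ (n : ℤ) % 2 ≠ h % 2 := by
  by_cases hz : ∀ p, s p ≠ 0
  · exact Or.inl hz
  · push Not at hz
    obtain ⟨z, hz⟩ := hz
    right
    have hne : signCount (n - 1) h ≠ 0 := by
      rw [← card_stepSeqs_filter_zero n h z, Finset.card_ne_zero]
      exact ⟨s, Finset.mem_filter.mpr ⟨hs, hz⟩⟩
    intro hcon
    refine hne (signCount_eq_zero fun k _ hk => ?_)
    have := z.2
    omega

theorem parity_of_ne_zero {n : ℕ} {h : ℤ} {s : Fin n → ℤ} (hs : s ∈ stepSeqs n h)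
    (hz : ∀ p, s p ≠ 0) : (n : ℤ) % 2 = h % 2 := by
  have : s ∈ signSeqs (Fin n) h := by
    rw [signSeqs_eq_filter]
    exact Finset.mem_filter.mpr ⟨hs, hz⟩
  obtain ⟨k, -, hk⟩ := exists_of_mem_signSeqs this
  rw [Fintype.card_fin] at hk
  omega

theorem mem_stepFamilies_iff {s : ∀ i, Fin (m i) → ℤ} :
    s ∈ stepFamilies m ↔ (∃ h, ∀ i, s i ∈ stepSeqs (m i) h) ∧ ∃ i, ∀ p, s i p ≠ 0 := by
  simp only [mem_stepSeqs]
  constructor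
  · rintro ⟨h1, h2, ⟨h, h3⟩, h4⟩
    exact ⟨⟨h, fun i => ⟨h1 i, h2 i, h3 i⟩⟩, h4⟩
  · rintro ⟨⟨h, h1⟩, h4⟩
    exact ⟨fun i => (h1 i).1, fun i => (h1 i).2.1, ⟨h, fun i => (h1 i).2.2⟩, h4⟩

theorem mem_Icc_of_mem_stepSeqs {n M : ℕ} (hM : n ≤ M) {h : ℤ} {s : Fin n → ℤ}
    (hs : s ∈ stepSeqs n h) : h ∈ Finset.Icc (-(M : ℤ)) M := by
  obtain ⟨h1, -, h3⟩ := mem_stepSeqs.mp hs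
  have := abs_le.mp (abs_sum_le_of_forall h1)
  rw [Finset.mem_Icc]
  omega

/-- If both parities occur among the path lengths, then some path has length of the parity of the
common sum. The sequence of that path has no zero, so this condition on families is automatic. -/
theorem ncard_stepFamilies_of_mixed (heven : ∃ i, Even (m i)) (hodd : ∃ i, Odd (m i)) {M : ℕ}
    (hM : ∀ i, m i ≤ M) :
    (stepFamilies m).ncard = ∑ h ∈ Finset.Icc (-(M : ℤ)) M, ∏ i, (stepSeqs (m i) h).card := by
  obtain ⟨i₀, hi₀⟩ := heven
  obtain ⟨i₁, hi₁⟩ := hodd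
  rw [Nat.even_iff] at hi₀
  rw [Nat.odd_iff] at hi₁
  rw [← card_biUnion_piFinset (fun i h => stepSeqs (m i) h) i₀
    fun i h s hs => (mem_stepSeqs.mp hs).2.2, ← Set.ncard_coe_finset]
  congr 1
  ext s
  simp only [mem_stepFamilies_iff, Finset.coe_biUnion, Set.mem_iUnion, Finset.mem_coe,
    Fintype.mem_piFinset, exists_prop]
  constructor
  · rintro ⟨⟨h, hs⟩, -⟩
    exact ⟨h, mem_Icc_of_mem_stepSeqs (hM i₀) (hs i₀), hs⟩
  · rintro ⟨h, -, hs⟩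
    refine ⟨⟨h, hs⟩, ?_⟩
    rcases forall_ne_zero_or_parity_ne (hs i₀) with h0 | h0
    · exact ⟨i₀, h0⟩
    rcases forall_ne_zero_or_parity_ne (hs i₁) with h1 | h1
    · exact ⟨i₁, h1⟩
    omega

/-- If all path lengths have the same parity, then a sequence without zeros forces the parity of the
common sum, and with it the absence of zeros in all other sequences. -/
theorem facetCount_CB_of_same_parity (hpos : ∀ i, 1 ≤ m i) (i₀ : Fin t)
    (hpar : ∀ i j, m i % 2 = m j % 2) : facetCount (CB m) = F m := by
  have hM : ∀ i, m i ≤ ∑ j, m j := fun i =>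
    Finset.single_le_sum (fun _ _ => Nat.zero_le _) (Finset.mem_univ i)
  rw [facetCount_CB hpos i₀, ← sum_prod_signCount m i₀ hpar hM]
  simp only [signCount]
  rw [← card_biUnion_piFinset (fun i h => signSeqs (Fin (m i)) h) i₀
    fun i h s hs => (mem_signSeqs.mp hs).2, ← Set.ncard_coe_finset]
  congr 1
  ext s
  simp only [mem_stepFamilies_iff, Finset.coe_biUnion, Set.mem_iUnion, Finset.mem_coe,
    Fintype.mem_piFinset, exists_prop, signSeqs_eq_filter, Finset.mem_filter]
  constructor
  · rintro ⟨⟨h, hs⟩, i, hi⟩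
    refine ⟨h, mem_Icc_of_mem_stepSeqs (hM i₀) (hs i₀), fun j => ⟨hs j, ?_⟩⟩
    refine (forall_ne_zero_or_parity_ne (hs j)).resolve_right fun hj => hj ?_
    have h1 := parity_of_ne_zero (hs i) hi
    have h2 := hpar i j
    omega
  · rintro ⟨h, -, hs⟩
    exact ⟨⟨h, fun i => (hs i).1⟩, i₀, (hs i₀).2⟩

theorem prod_card_stepSeqs (heven : ∃ i, Even (m i)) (hodd : ∃ i, Odd (m i)) (h : ℤ) :
    ∏ i, (stepSeqs (m i) h).card =
      (∏ i with Even (m i), m i) * ∏ i, signCount (subEven m i) h +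
        (∏ i with Odd (m i), m i) * ∏ i, signCount (subOdd m i) h := by
  -- One of the two summands vanishes, depending on the parity of `h`.
  have hcount : ∀ {n : ℕ}, (n : ℤ) % 2 ≠ h % 2 → signCount n h = 0 := fun hn =>
    signCount_eq_zero fun k _ hk => hn (by omega)
  have hcount' : ∀ {n : ℕ}, (n : ℤ) % 2 = h % 2 → n * signCount (n - 1) h = 0 := fun {n} hn => by
    rcases Nat.eq_zero_or_pos n with rfl | hn0
    · simp
    · rw [hcount (by omega), mul_zero]
  obtain ⟨i₀, hi₀⟩ := heven
  obtain ⟨i₁, hi₁⟩ := hodd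
  rw [Finset.prod_filter, Finset.prod_filter, ← Finset.prod_mul_distrib, ← Finset.prod_mul_distrib]
  rcases Int.emod_two_eq_zero_or_one h with hh | hh
  · rw [Finset.prod_eq_zero (Finset.mem_univ i₁) (f := fun i =>
      (if Even (m i) then m i else 1) * signCount (subEven m i) h), zero_add]
    · refine Finset.prod_congr rfl fun i _ => ?_
      rw [card_stepSeqs, subOdd]
      by_cases hi : Odd (m i)
      · have := Nat.odd_iff.mp hi
        rw [if_pos hi, if_pos hi, hcount (n := m i) (by omega), zero_add]
      · have := Nat.not_odd_iff.mp hi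
        rw [if_neg hi, if_neg hi, hcount' (n := m i) (by omega), add_zero, one_mul]
    · have := Nat.odd_iff.mp hi₁
      rw [subEven, if_neg (Nat.not_even_iff_odd.mpr hi₁), if_neg (Nat.not_even_iff_odd.mpr hi₁),
        hcount (n := m i₁) (by omega),
        mul_zero]
  · rw [Finset.prod_eq_zero (Finset.mem_univ i₀) (f := fun i =>
      (if Odd (m i) then m i else 1) * signCount (subOdd m i) h), add_zero]
    · refine Finset.prod_congr rfl fun i _ => ?_
      rw [card_stepSeqs, subEven]
      by_cases hi : Even (m i)
      · have := Nat.even_iff.mp hi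
        rw [if_pos hi, if_pos hi, hcount (n := m i) (by omega), zero_add]
      · have := Nat.not_even_iff.mp hi
        rw [if_neg hi, if_neg hi, hcount' (n := m i) (by omega), add_zero, one_mul]
    · have := Nat.even_iff.mp hi₀
      rw [subOdd, if_neg (Nat.not_odd_iff_even.mpr hi₀), if_neg (Nat.not_odd_iff_even.mpr hi₀),
        hcount (n := m i₀) (by omega),
        mul_zero]

theorem facetCount_CB_of_mixed (hpos : ∀ i, 1 ≤ m i) (heven : ∃ i, Even (m i))
    (hodd : ∃ i, Odd (m i)) :
    facetCount (CB m) = (∏ i with Even (m i), m i) * F (subEven m) +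
      (∏ i with Odd (m i), m i) * F (subOdd m) := by
  obtain ⟨i₀, hi₀⟩ := id heven
  have hM : ∀ i, m i ≤ ∑ j, m j := fun i =>
    Finset.single_le_sum (fun _ _ => Nat.zero_le _) (Finset.mem_univ i)
  have he : ∀ i, subEven m i % 2 = 1 := fun i => by
    have := hpos i
    unfold subEven
    split_ifs with h
    · rw [Nat.even_iff] at h
      omega
    · exact Nat.not_even_iff.mp h
  have ho : ∀ i, subOdd m i % 2 = 0 := fun i => by
    unfold subOdd
    split_ifs with h
    · rw [Nat.odd_iff] at h
      omega
    · exact Nat.not_odd_iff.mp h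
  have hle : ∀ i, subEven m i ≤ m i := fun i => by unfold subEven; split_ifs <;> omega
  have hlo : ∀ i, subOdd m i ≤ m i := fun i => by unfold subOdd; split_ifs <;> omega
  rw [facetCount_CB hpos i₀, ncard_stepFamilies_of_mixed heven hodd hM,
    Finset.sum_congr rfl fun h _ => prod_card_stepSeqs heven hodd h, Finset.sum_add_distrib,
    ← Finset.mul_sum, ← Finset.mul_sum,
    sum_prod_signCount (subEven m) i₀ (fun i j => by rw [he, he]) fun i => (hle i).trans (hM i),
    sum_prod_signCount (subOdd m) i₀ (fun i j => by rw [ho, ho]) fun i => (hlo i).trans (hM i)]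

end FacetCountCB

/-! ### Wedges -/

section Wedge

universe u v w

/-- `W` is the wedge of `G` and `H` along the inclusions `f` and `g`, which identify `a` with `b`.
In contrast with `IsWedge`, the inclusions and the identified vertices are named. -/
structure IsWedgeAt {A : Type u} {B : Type v} {V : Type w} (G : SimpleGraph A) (H : SimpleGraph B)
    (W : SimpleGraph V) (f : A → V) (g : B → V) (a : A) (b : B) : Prop where
  inj_left : Function.Injective f
  inj_right : Function.Injective g
  map_base : f a = g b
  eq_base : ∀ y z, f y = g z → y = a ∧ z = b
  cover : ∀ x, (∃ y, f y = x) ∨ ∃ z, g z = x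
  adj_iff : ∀ x x', W.Adj x x' ↔
    (∃ y y', G.Adj y y' ∧ f y = x ∧ f y' = x') ∨ ∃ z z', H.Adj z z' ∧ g z = x ∧ g z' = x'

variable {A : Type u} {B : Type v} {V : Type w} {G : SimpleGraph A} {H : SimpleGraph B}
  {W : SimpleGraph V} {f : A → V} {g : B → V} {a : A} {b : B}

theorem IsWedge.exists_isWedgeAt (h : IsWedge G H W) : ∃ f g a b, IsWedgeAt G H W f g a b := by
  obtain ⟨f, g, ⟨x, hx⟩, hU, rfl⟩ := h
  have hmem : x ∈ Set.range f ∩ Set.range g := hx ▸ Set.mem_singleton x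
  obtain ⟨⟨a, ha⟩, b, hb⟩ := hmem
  refine ⟨f, g, a, b, f.injective, g.injective, ha.trans hb.symm, fun y z hyz => ?_, fun v => ?_,
    fun v v' => ?_⟩
  · have h1 : f y ∈ Set.range f ∩ Set.range g := ⟨⟨y, rfl⟩, z, hyz.symm⟩
    rw [hx, Set.mem_singleton_iff] at h1
    exact ⟨f.injective (h1.trans ha.symm), g.injective (hyz.symm.trans (h1.trans hb.symm))⟩
  · have : v ∈ Set.range f ∪ Set.range g := hU ▸ Set.mem_univ v
    exact this
  · rw [SimpleGraph.sup_adj, SimpleGraph.map_adj, SimpleGraph.map_adj]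

namespace IsWedgeAt

theorem symm (h : IsWedgeAt G H W f g a b) : IsWedgeAt H G W g f b a where
  inj_left := h.inj_right
  inj_right := h.inj_left
  map_base := h.map_base.symm
  eq_base z y hzy := (h.eq_base y z hzy.symm).symm
  cover x := (h.cover x).symm
  adj_iff x x' := (h.adj_iff x x').trans or_comm

/-- The retraction of a wedge onto its first part, which collapses the second part to the identified
vertex. -/
theorem exists_retraction (h : IsWedgeAt G H W f g a b) :
    ∃ r : V → A, (∀ y, r (f y) = y) ∧ ∀ z, r (g z) = a := by
  classical
  refine ⟨fun x => if hx : ∃ y, f y = x then hx.choose else a, fun y => ?_, fun z => ?_⟩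
  · have hy : ∃ y', f y' = f y := ⟨y, rfl⟩
    simp only [hy, dif_pos]
    exact h.inj_left hy.choose_spec
  · by_cases hz : ∃ y, f y = g z
    · simp only [hz, dif_pos]
      exact (h.eq_base _ _ hz.choose_spec).1
    · simp only [hz, dif_neg, not_false_eq_true]

theorem restrict_mem (h : IsWedgeAt G H W f g a b) {φ : V → ℤ}
    (hφ : φ ∈ facetFunctions W (f a)) : φ ∘ f ∈ facetFunctions G a := by
  obtain ⟨h0, hle, hreach⟩ := hφ
  obtain ⟨r, hrf, hrg⟩ := h.exists_retraction
  refine ⟨h0, fun y y' hy => hle _ _ ((h.adj_iff _ _).mpr (Or.inl ⟨y, y', hy, rfl, rfl⟩)),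
    fun y => ?_⟩
  have hlift : Relation.ReflTransGen (Tight G (φ ∘ f)) (r (f a)) (r (f y)) :=
    Relation.ReflTransGen.lift' r (fun x x' hxx' => ?_) _ _ (hreach (f y))
  · rwa [hrf, hrf] at hlift
  · obtain ⟨hadj, habs⟩ := hxx'
    rcases (h.adj_iff _ _).mp hadj with ⟨y, y', hy, rfl, rfl⟩ | ⟨z, z', hz, rfl, rfl⟩
    · show Relation.ReflTransGen _ (r (f y)) (r (f y'))
      rw [hrf, hrf]
      exact .single ⟨hy, habs⟩
    · show Relation.ReflTransGen _ (r (g z)) (r (g z'))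
      rw [hrg, hrg]

theorem ncard_facetFunctions (h : IsWedgeAt G H W f g a b) :
    (facetFunctions W (f a)).ncard = (facetFunctions G a).ncard * (facetFunctions H b).ncard := by
  rw [← Set.ncard_prod]
  refine Set.ncard_congr (fun φ _ => (φ ∘ f, φ ∘ g)) (fun φ hφ => ⟨h.restrict_mem hφ,
    h.symm.restrict_mem (h.map_base ▸ hφ)⟩) (fun φ ψ _ _ heq => ?_) ?_
  · funext x
    rw [Prod.mk.injEq] at heq
    rcases h.cover x with ⟨y, rfl⟩ | ⟨z, rfl⟩
    · exact congrFun heq.1 y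
    · exact congrFun heq.2 z
  · rintro ⟨φ₁, φ₂⟩ ⟨h₁, h₂⟩
    obtain ⟨r, hrf, hrg⟩ := h.exists_retraction
    obtain ⟨q, hqg, hqf⟩ := h.symm.exists_retraction
    obtain ⟨h10, h1le, h1reach⟩ := h₁
    obtain ⟨h20, h2le, h2reach⟩ := h₂
    dsimp only at h10 h1le h1reach h20 h2le h2reach
    let φ : V → ℤ := fun x => φ₁ (r x) + φ₂ (q x)
    have hφf : ∀ y, φ (f y) = φ₁ y := fun y => by simp [φ, hrf, hqf, h20]
    have hφg : ∀ z, φ (g z) = φ₂ z := fun z => by simp [φ, hrg, hqg, h10]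
    refine ⟨φ, ⟨by rw [hφf, h10], fun x x' hxx' => ?_, fun x => ?_⟩,
      Prod.ext (funext hφf) (funext hφg)⟩
    · rcases (h.adj_iff _ _).mp hxx' with ⟨y, y', hy, rfl, rfl⟩ | ⟨z, z', hz, rfl, rfl⟩
      · rw [hφf, hφf]
        exact h1le y y' hy
      · rw [hφg, hφg]
        exact h2le z z' hz
    · rcases h.cover x with ⟨y, rfl⟩ | ⟨z, rfl⟩
      · refine Relation.ReflTransGen.lift f (fun y y' hy => ⟨?_, ?_⟩) _ _ (h1reach y)
        · exact (h.adj_iff _ _).mpr (Or.inl ⟨y, y', hy.1, rfl, rfl⟩)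
        · rw [hφf, hφf]
          exact hy.2
      · rw [h.map_base]
        refine Relation.ReflTransGen.lift g (fun z z' hz => ⟨?_, ?_⟩) _ _ (h2reach z)
        · exact (h.adj_iff _ _).mpr (Or.inr ⟨z, z', hz.1, rfl, rfl⟩)
        · rw [hφg, hφg]
          exact hz.2

theorem connected (h : IsWedgeAt G H W f g a b) (hG : G.Connected) (hH : H.Connected) :
    W.Connected := by
  have : Nonempty V := ⟨f a⟩
  let F : G →g W := ⟨f, fun {y y'} hy => (h.adj_iff _ _).mpr (Or.inl ⟨y, y', hy, rfl, rfl⟩)⟩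
  let F' : H →g W := ⟨g, fun {z z'} hz => (h.adj_iff _ _).mpr (Or.inr ⟨z, z', hz, rfl, rfl⟩)⟩
  have hreach : ∀ x, W.Reachable (f a) x := fun x => by
    rcases h.cover x with ⟨y, rfl⟩ | ⟨z, rfl⟩
    · exact (hG.preconnected a y).map F
    · rw [h.map_base]
      exact (hH.preconnected b z).map F'
  exact ⟨fun x y => (hreach x).symm.trans (hreach y)⟩

theorem finite [Finite A] [Finite B] (h : IsWedgeAt G H W f g a b) : Finite V := by
  refine Finite.of_surjective (Sum.elim f g) fun x => ?_
  rcases h.cover x with ⟨y, rfl⟩ | ⟨z, rfl⟩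
  · exact ⟨Sum.inl y, rfl⟩
  · exact ⟨Sum.inr z, rfl⟩

end IsWedgeAt

/-! ### Cycles -/

theorem comp_iso_mem_facetFunctions (e : G ≃g H) {a : A} {φ : B → ℤ}
    (hφ : φ ∈ facetFunctions H (e a)) : φ ∘ e ∈ facetFunctions G a := by
  obtain ⟨h0, hle, hreach⟩ := hφ
  refine ⟨h0, fun y y' hy => hle _ _ (e.map_rel_iff.mpr hy), fun y => ?_⟩
  have : Relation.ReflTransGen (Tight G (φ ∘ e)) (e.symm (e a)) (e.symm (e y)) :=
    Relation.ReflTransGen.lift e.symm (fun z z' hz => ?_) _ _ (hreach (e y))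
  · simpa using this
  · exact ⟨e.symm.map_rel_iff.mpr hz.1, by simpa using hz.2⟩

theorem ncard_facetFunctions_of_iso (e : G ≃g H) (a : A) :
    (facetFunctions G a).ncard = (facetFunctions H (e a)).ncard := by
  symm
  refine Set.ncard_congr (fun φ _ => φ ∘ e) (fun φ hφ => comp_iso_mem_facetFunctions e hφ)
    (fun φ ψ _ _ h => e.surjective.injective_comp_right h) fun ψ hψ => ?_
  refine ⟨ψ ∘ e.symm, comp_iso_mem_facetFunctions e.symm (by simpa using hψ), ?_⟩
  funext x
  simp

theorem facetCount_of_iso [Finite A] [Finite B] [Nontrivial A] (e : G ≃g H)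
    (hH : H.Connected) : facetCount G = facetCount H := by
  have := e.symm.surjective.nontrivial
  have hG : G.Connected := e.connected_iff.mpr hH
  obtain ⟨a⟩ := hG.nonempty
  rw [facetCount_eq_ncard hG a, facetCount_eq_ncard hH (e a), ncard_facetFunctions_of_iso e a]

theorem cycleGraph_adj_iff_val {n : ℕ} (hn : 2 ≤ n) (u v : Fin n) :
    (SimpleGraph.cycleGraph n).Adj u v ↔ (u : ℕ) + 1 = v ∨ (v : ℕ) + 1 = u ∨
      (u = (0 : ℕ) ∧ (v : ℕ) = n - 1) ∨ (v = (0 : ℕ) ∧ (u : ℕ) = n - 1) := by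
  have hu := u.2
  have hv := v.2
  have key : ∀ u v : Fin n, (u - v).val = 1 ↔
      (v : ℕ) + 1 = u ∨ (u = (0 : ℕ) ∧ (v : ℕ) = n - 1) := by
    intro u v
    have hu := u.2
    have hv := v.2
    rw [Fin.val_sub]
    rcases le_or_gt v.val u.val with h | h
    · rw [show n - v.val + u.val = (u - v : ℕ) + n by omega, Nat.add_mod_right,
        Nat.mod_eq_of_lt (by omega)]
      omega
    · rw [Nat.mod_eq_of_lt (by omega)]
      omega
  rw [SimpleGraph.cycleGraph_adj', key, key]
  omega

/-- A cycle with `n` edges consists of a path with `n - 1` edges and one closing edge. -/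
theorem nonempty_cycleGraph_iso_CB {n : ℕ} (hn : 2 ≤ n) :
    Nonempty (SimpleGraph.cycleGraph n ≃g CB ![n - 1, 1]) := by
  set m : Fin 2 → ℕ := ![n - 1, 1] with hm
  have hpos : ∀ i, 1 ≤ m i := by
    intro i
    fin_cases i
    · show 1 ≤ n - 1
      omega
    · exact le_rfl
  have hm0 : m 0 = n - 1 := rfl
  have hm1 : m 1 = 1 := rfl
  have hinj : ∀ p p', p ≤ n - 1 → p' ≤ n - 1 → cbPathVertex m 0 p = cbPathVertex m 0 p' →
      p = p' := by
    intro p p' hp hp' h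
    rcases lt_trichotomy p p' with hlt | heq | hlt
    · exact (cbPathVertex_inj (by omega) (by omega) h.symm).1.symm
    · exact heq
    · exact (cbPathVertex_inj (by omega) (by omega) h).1
  have h10 : cbPathVertex m 1 0 = cbPathVertex m 0 0 := by
    rw [cbPathVertex_zero, cbPathVertex_zero]
  have h11 : cbPathVertex m 1 1 = cbPathVertex m 0 (n - 1) := by
    have h1 := cbPathVertex_end (m := m) 1 (hpos 1)
    have h0 := cbPathVertex_end (m := m) 0 (hpos 0)
    rw [hm1] at h1
    rw [hm0] at h0
    rw [h1, h0]
  let φ : Fin n → CBVertex m := fun p => cbPathVertex m 0 p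
  have hφi : Function.Injective φ := fun p p' h =>
    Fin.ext (hinj p p' (by omega) (by omega) h)
  have hφs : Function.Surjective φ := by
    intro x
    obtain ⟨i, p, hp, rfl⟩ := exists_eq_cbPathVertex hpos 0 x
    fin_cases i
    · exact ⟨⟨p, by have : p ≤ n - 1 := hp; omega⟩, rfl⟩
    · have hp1 : p ≤ 1 := hp
      interval_cases p
      · exact ⟨⟨0, by omega⟩, h10.symm⟩
      · exact ⟨⟨n - 1, by omega⟩, h11.symm⟩
  refine ⟨⟨Equiv.ofBijective φ ⟨hφi, hφs⟩, ?_⟩⟩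
  intro u v
  show (CB m).Adj (φ u) (φ v) ↔ _
  have hu := u.2
  have hv := v.2
  rw [CB_adj_iff, cycleGraph_adj_iff_val hn, Fin.exists_fin_two]
  constructor
  · rintro (⟨p, hp, ⟨h1, h2⟩ | ⟨h1, h2⟩⟩ | ⟨p, hp, h⟩)
    · have := hinj _ _ (by omega) (by omega) h1
      have := hinj _ _ (by omega) (by omega) h2
      omega
    · have := hinj _ _ (by omega) (by omega) h1
      have := hinj _ _ (by omega) (by omega) h2
      omega
    · have hp0 : p = 0 := by omega
      subst hp0
      rw [zero_add, h10, h11] at h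
      rcases h with ⟨h1, h2⟩ | ⟨h1, h2⟩
      · have := hinj _ _ (by omega) (by omega) h1
        have := hinj _ _ (by omega) (by omega) h2
        omega
      · have := hinj _ _ (by omega) (by omega) h1
        have := hinj _ _ (by omega) (by omega) h2
        omega
  · rintro (h | h | ⟨h1, h2⟩ | ⟨h1, h2⟩)
    · exact Or.inl ⟨u, by omega, Or.inl ⟨rfl, by rw [h]⟩⟩
    · exact Or.inl ⟨v, by omega, Or.inr ⟨rfl, by rw [h]⟩⟩
    · refine Or.inr ⟨0, by omega, Or.inl ⟨?_, ?_⟩⟩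
      · rw [h10, ← h1]
      · rw [zero_add, h11, ← h2]
    · refine Or.inr ⟨0, by omega, Or.inr ⟨?_, ?_⟩⟩
      · rw [h10, ← h1]
      · rw [zero_add, h11, ← h2]

/-- Pascal's rule, applied to the two values `±1` of a facet function at the far endpoint of the
closing edge. -/
theorem F_pair (k : ℕ) : F ![2 * k + 1, 1] = (2 * k + 2).choose (k + 1) := by
  rw [F_of_antitone]
  · simp [Finset.sum_range_succ, Nat.choose_succ_succ]
  · intro i j hij
    fin_cases i <;> fin_cases j <;> simp_all

theorem facetCount_cycle {V : Type u} {W : SimpleGraph V} {n : ℕ} (hn : 2 ≤ n) (heven : Even n)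
    (e : W ≃g SimpleGraph.cycleGraph n) :
    Finite V ∧ Nontrivial V ∧ W.Connected ∧ facetCount W = n.choose (n / 2) := by
  obtain ⟨e'⟩ := nonempty_cycleGraph_iso_CB hn
  have e'' : W ≃g CB ![n - 1, 1] := e.trans e'
  obtain ⟨k, rfl⟩ : ∃ k, n = 2 * k + 2 := by
    obtain ⟨r, rfl⟩ := heven
    exact ⟨r - 1, by omega⟩
  have hpos : ∀ i, 1 ≤ (![2 * k + 2 - 1, 1] : Fin 2 → ℕ) i := by
    intro i
    fin_cases i <;> simp
  have hconn := CB_connected hpos 0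
  have hfin : Finite V := Finite.of_equiv _ e.symm.toEquiv
  have : Nontrivial (Fin (2 * k + 2)) := ⟨⟨0, 1, by simp⟩⟩
  have hnt : Nontrivial V := e.surjective.nontrivial
  refine ⟨hfin, hnt, e''.connected_iff.mpr hconn, ?_⟩
  rw [facetCount_of_iso e'' hconn, facetCount_CB_of_same_parity hpos 0]
  · have h1 : 2 * k + 2 - 1 = 2 * k + 1 := by omega
    have h2 : (2 * k + 2) / 2 = k + 1 := by omega
    rw [h1, h2, F_pair]
  · intro i j
    fin_cases i <;> fin_cases j <;> simp

/-- The number of facets is multiplicative over wedges, and an even cycle of length `n` has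
`n.choose (n / 2)` of them. -/
theorem facetCount_of_isWedgeOfCycles {V : Type u} {s : Multiset ℕ} {W : SimpleGraph V}
    (hW : IsWedgeOfCycles s W) (hs : ∀ n ∈ s, 2 ≤ n ∧ Even n) :
    Finite V ∧ Nontrivial V ∧ W.Connected ∧
      facetCount W = (s.map fun n => n.choose (n / 2)).prod := by
  induction hW with
  | cycle n W h =>
    obtain ⟨e⟩ := h
    obtain ⟨h2, heven⟩ := hs n (Multiset.mem_singleton_self n)
    simpa using facetCount_cycle h2 heven e
  | @wedge A B V s s' G H W _ _ hW ihG ihH =>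
    obtain ⟨_, _, hGc, hG⟩ := ihG fun n hn => hs n (Multiset.mem_add.mpr (Or.inl hn))
    obtain ⟨_, _, hHc, hH⟩ := ihH fun n hn => hs n (Multiset.mem_add.mpr (Or.inr hn))
    obtain ⟨f, g, a, b, h⟩ := hW.exists_isWedgeAt
    have hfin := h.finite
    have hnt := h.inj_left.nontrivial
    have hconn := h.connected hGc hHc
    refine ⟨hfin, hnt, hconn, ?_⟩
    rw [Multiset.map_add, Multiset.prod_add, ← hG, ← hH, facetCount_eq_ncard hconn (f a),
      facetCount_eq_ncard hGc a, facetCount_eq_ncard hHc b, h.ncard_facetFunctions]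

end Wedge

theorem F_of_exists_eq_zero {t : ℕ} {m : Fin t → ℕ} (h : ∃ i, m i = 0) :
    F m = ∏ i, (m i).choose (m i / 2) := by
  obtain ⟨i, hi⟩ := h
  have hmin : (⨅ i, m i) = 0 := Nat.le_zero.mp (hi ▸ ciInf_le (OrderBot.bddBelow _) i)
  simp [F, hmin]

end SymEdge

theorem mainTheorem5 {t : ℕ} (m : Fin t → ℕ) (hpos : ∀ i, 1 ≤ m i)
    (heven : ∃ i, Even (m i)) (hodd : ∃ i, Odd (m i)) :
    ((∀ i, 2 ≤ m i) →
      SymEdge.facetCount (SymEdge.CB m) =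
        (∏ i with Even (m i), m i) * SymEdge.F (SymEdge.subEven m) +
          (∏ i with Odd (m i), m i) * SymEdge.F (SymEdge.subOdd m)) ∧
    ((∃ i, m i = 1) →
      ∀ {V : Type*} (W : SimpleGraph V),
        SymEdge.IsWedgeOfCycles
          ((Finset.univ.filter fun i => m i ≠ 1).val.map (SymEdge.subOdd m)) W →
        SymEdge.facetCount (SymEdge.CB m) =
          (∏ i with Even (m i), m i) * SymEdge.F (SymEdge.subEven m) +
            (∏ i with Odd (m i), m i) * SymEdge.facetCount W) := by
  have hmain := SymEdge.facetCount_CB_of_mixed hpos heven hodd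
  refine ⟨fun _ => hmain, fun ⟨i₁, hi₁⟩ V W hW => ?_⟩
  have hsub : ∀ i, m i = 1 → SymEdge.subOdd m i = 0 := fun i hi => by
    simp [SymEdge.subOdd, hi]
  rw [hmain, SymEdge.F_of_exists_eq_zero ⟨i₁, hsub i₁ hi₁⟩,
    (SymEdge.facetCount_of_isWedgeOfCycles hW ?_).2.2.2, Multiset.map_map]
  · congr 2
    -- The paths of length one contribute trivial factors to the product.
    refine (Finset.prod_subset (Finset.filter_subset (fun i => m i ≠ 1) _) fun i _ hi => ?_).symm
    have hi1 : m i = 1 := by simpa using hi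
    rw [hsub i hi1]
    rfl
  · intro n hn
    obtain ⟨i, hi, rfl⟩ := Multiset.mem_map.mp hn
    have hi1 : m i ≠ 1 := (Finset.mem_filter.mp (Finset.mem_val.mp hi)).2
    have hp := hpos i
    unfold SymEdge.subOdd
    split_ifs with h
    · rw [Nat.odd_iff] at h
      exact ⟨by omega, Nat.even_iff.mpr (by omega)⟩
    · exact ⟨by omega, Nat.not_odd_iff_even.mp h⟩
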